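/- Let $(X,d)$ be a metric space that is geometrically doubling with constant $M$ (every ball of radius $r$ is covered by at most $M$ balls of radius $r/2$), and let $0<\delta<1/(2\cdot 168M^8)$. A \emph{dyadic system} (of scale $\delta$) is a family $\mathscr D=\{Q_\alpha^k : k\in\mathbb Z,\ \alpha\in\mathscr A_k\}$ of subsets of $X$ (cubes), with center points $z_\alpha^k\in X$, such that: for every $k$ the cubes $Q^k_\alpha$ of level $k$ are pairwise disjoint with union $X$; $P\cap Q\in\{\emptyset,P,Q\}$ for all $P,Q\in\mathscr D$; $B(z_\alpha^k,\frac15\delta^k)\subseteq Q_\alpha^k\subseteq B(z_\alpha^k,3\delta^k)$; and $Q_\alpha^k=\bigcup\{Q_\beta^{k+n} : Q_\beta^{k+n}\subseteq Q_\alpha^k\}$ for every $n\in\mathbb N$. For $Q=Q_\alpha^k$ (a set together with its level and index) write $\mathrm{lev}(Q)=k$, $\ell(Q)=\delta^k$ and $cB_Q=B(z_\alpha^k,3c\,\delta^k)$; $\mathscr D^k$ is the collection of cubes of level $k$, and $Q^{(p)}$ is the unique cube of level $k-p$ that contains $Q$. Dyadic systems $\mathscr D(1),\dots,\mathscr D(K)$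 of the same scale $\delta$ are \emph{adjacent} (for two balls) if for every $p\in\mathbb N$ and all balls $B_1,B_2$ there are $\omega$ and cubes $Q_1,Q_2\in\mathscr D(\omega)$ with $B_i\subseteq Q_i$, $\ell(Q_i)\le\delta^{-2}r(B_i)$ and $\delta^{-p}B_i\subseteq Q_i^{(p)}$ for $i=1,2$. Proposition. There is a number $L$ depending only on $M$ and $\delta$ such that the following holds. Let $\mathscr D$ be a dyadic system and $\mathscr D(1),\dots,\mathscr D(K)$ adjacent dyadic systems on $X$, all of scale $\delta$; let $m\ge1$ be real, and let $\tau:\mathscr D\to\mathscr D$ be injective with $\tau(\mathscr D^k)\subseteq\mathscr D^k$ for every $k\in\mathbb Z$ and $\tau(Q)\subseteq mB_Q$ for every $Q\in\mathscr D$. Let $T\ge1$ be the smallest positive integer with $2m\delta^T\le1$; then $T\le 1+\log(2m)/\log(1/\delta)$. The system $\mathscr D$ is a disjoint union of $L\cdot 4T\cdot K$ (possibly empty) subcollections $\mathscr D_\lambda$, $\lambda=(i,j,\omega)$, with $1\le i\le L$, $0\le j<4T$, $1\le\omega\le K$, such that for every $\lambda=(i,j,\omega)$ and every $k$ and $Q\in\mathscr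 D_\lambda\cap\mathscr D^k$ there are cubes $P_Q,P_{\tau(Q)}\in\mathscr D(\omega)^{k-3}$ and $P_Q^*\in\mathscr D(\omega)^{k-3-T}$ satisfying: 1. $Q\subseteq P_Q$, $\tau(Q)\subseteq P_{\tau(Q)}$ and $P_Q\cup P_{\tau(Q)}\cup 2mB_Q\subseteq P_Q^*$; 2. if $Q_1,Q_2\in\mathscr D_\lambda\cap\mathscr D^k$ and $Q_1\ne Q_2$, then $(P_{Q_1}\cup P_{\tau(Q_1)})\cap(P_{Q_2}\cup P_{\tau(Q_2)})=\emptyset$; 3. if $Q_1,Q_2\in\mathscr D_\lambda$ and $Q_1\subsetneq Q_2$ (as sets), then $P_{Q_1}^*\subseteq P_{Q_2}$. -/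

import Mathlib

open Set Metric

universe u

/-- `X` is geometrically doubling with constant `M`: every ball of radius `r` can be covered by at
most `M` balls of radius `r / 2`. -/
def GeometricallyDoubling (X : Type u) [MetricSpace X] (M : ℕ) : Prop :=
  ∀ (x : X) (r : ℝ), 0 < r →
    ∃ s : Finset X, s.card ≤ M ∧ ball x r ⊆ ⋃ y ∈ s, ball y (r / 2)

/-- A system of dyadic cubes of scale `δ` in a metric space. The cubes are an indexed family
`(Q_α^k)`, `k ∈ ℤ`, `α ∈ Idx k`, so that cubes of different levels are different cubes even when
they are the same set of points (which happens, e.g., in bounded spaces). -/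
structure DyadicSystem (X : Type u) [MetricSpace X] (δ : ℝ) where
  /-- the indices of the cubes of level `k` -/
  Idx : ℤ → Type u
  /-- the center point `z_α^k` -/
  z : (k : ℤ) → Idx k → X
  /-- the cube `Q_α^k` as a set of points -/
  Q : (k : ℤ) → Idx k → Set X
  /-- the cubes of each level cover the space -/
  cover : ∀ k, ⋃ α, Q k α = univ
  /-- different cubes of the same level are disjoint -/
  disjoint : ∀ k α β, α ≠ β → Disjoint (Q k α) (Q k β)
  /-- any two cubes are nested or disjoint -/
  nested : ∀ k α l β, Q k α ∩ Q l β = ∅ ∨ Q k α ∩ Q l β = Q k α ∨ Q k α ∩ Q l β = Q l β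
  /-- every cube contains a ball around its center -/
  ball_subset : ∀ k α, ball (z k α) (1 / 5 * δ ^ k) ⊆ Q k α
  /-- every cube is contained in a ball around its center -/
  subset_ball : ∀ k α, Q k α ⊆ ball (z k α) (3 * δ ^ k)
  /-- every cube is the union of the cubes of level `k + m` that it contains -/
  eq_iUnion : ∀ k α (m : ℕ), Q k α = ⋃ β ∈ {β | Q (k + m) β ⊆ Q k α}, Q (k + m) β

namespace DyadicSystem

variable {X : Type u} [MetricSpace X] {δ : ℝ}

/-- The collection of all cubes of the system: a cube is a level together with an index. -/
def Cube (D : DyadicSystem X δ) : Type u := (k : ℤ) × D.Idx k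

variable {D : DyadicSystem X δ}

/-- The level (generation) of a cube. -/
def Cube.lev (R : D.Cube) : ℤ := R.1

/-- The set of points of a cube. -/
def Cube.pts (R : D.Cube) : Set X := D.Q R.1 R.2

/-- The center point `x_R` of a cube. -/
def Cube.center (R : D.Cube) : X := D.z R.1 R.2

/-- The dilated ball `c B_R = B(x_R, c · 3 δ^k)`, `k = lev R`. -/
def Cube.dilatedBall (c : ℝ) (R : D.Cube) : Set X := ball R.center (c * (3 * δ ^ R.lev))

/-- A nonempty cube has, for every `p`, exactly one dyadic ancestor `p` generations above it. -/
theorem Cube.existsUnique_ancestor (R : D.Cube) (hR : R.pts.Nonempty) (p : ℕ) :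
    ∃! S : D.Cube, S.lev = R.lev - p ∧ R.pts ⊆ S.pts := by
  obtain ⟨k, α⟩ := R
  obtain ⟨x, hx⟩ := hR
  change x ∈ D.Q k α at hx
  obtain ⟨l, rfl⟩ : ∃ l : ℤ, k = l + p := ⟨k - p, by ring⟩
  have hl : (l + p : ℤ) - p = l := by ring
  obtain ⟨β, hβ⟩ := mem_iUnion.1 ((D.cover l).symm ▸ mem_univ x)
  refine ⟨⟨l, β⟩, ⟨hl.symm, ?_⟩, ?_⟩
  · change D.Q (l + p) α ⊆ D.Q l β
    have h := hβ
    rw [D.eq_iUnion l β p] at h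
    simp only [mem_ofPred_eq, mem_iUnion, exists_prop] at h
    obtain ⟨γ, hγ, hxγ⟩ := h
    by_cases hαγ : α = γ
    · exact hαγ ▸ hγ
    · exact absurd hxγ (Set.disjoint_left.1 (D.disjoint _ _ _ hαγ) hx)
  · rintro ⟨l', β'⟩ ⟨h1, h2⟩
    change l' = (l + p : ℤ) - p at h1
    rw [hl] at h1
    subst h1
    have hx' : x ∈ D.Q l' β' := h2 hx
    by_cases hββ' : β' = β
    · rw [hββ']
    · exact absurd hβ (Set.disjoint_left.1 (D.disjoint _ _ _ hββ') hx')

/-- `S` is the dyadic ancestor `R^{(p)}` of `R`, i.e. the cube of generation `lev R - p` that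
contains `R`. -/
def Cube.IsAncestor (p : ℕ) (R S : D.Cube) : Prop :=
  S.lev = R.lev - p ∧ R.pts ⊆ S.pts

end DyadicSystem

/-- A finite family `𝒜 1, …, 𝒜 K` of dyadic systems of the same scale `δ` is adjacent for `n`
balls: for every `p` and all balls `B_1, …, B_n` one of the systems has cubes `Q_1, …, Q_n` with
`B_i ⊆ Q_i`, `ℓ(Q_i) ≤ δ⁻² r(B_i)` and `δ^{-p} B_i ⊆ Q_i^{(p)}`, where `ℓ(Q) = δ ^ lev Q`. -/
def IsAdjacentFamily {X : Type u} [MetricSpace X] {δ : ℝ} (n : ℕ) {K : ℕ}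
    (𝒜 : Fin K → DyadicSystem X δ) : Prop :=
  ∀ (p : ℕ) (x : Fin n → X) (r : Fin n → ℝ), (∀ i, 0 < r i) →
    ∃ ω : Fin K, ∀ i, ∃ R S : (𝒜 ω).Cube,
      ball (x i) (r i) ⊆ R.pts ∧
      δ ^ R.lev ≤ δ ^ (-2 : ℤ) * r i ∧
      R.IsAncestor p S ∧ ball (x i) (δ ^ (-(p : ℤ)) * r i) ⊆ S.pts

/-!
The idea is to let the adjacent systems supply the large cubes and to sort the cubes `Q` of `D` by
three parameters.

Apply adjacency, with `p = T`, to the balls `B_Q` and `B_{τ(Q)}`. As `3δ < 1`, the cubes it yields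
have level at least `lev Q - 2`, so that `Q` and `τ(Q)` lie in cubes `P_Q`, `P_{τ(Q)}` of
level `lev Q - 3`; and since `2mδ^T ≤ 1`, the ball `2mB_Q` is contained in `δ^{-T}B_Q`, hence in a
cube `P_Q^*` of level `lev Q - 3 - T` (`DyadicSystem.exists_good_index`). This attaches an
index `ω` to `Q`. All these cubes are found as the cube of the given level through the center
of `Q` or `τ(Q)` (`DyadicSystem.cubeAt`), so a single function `P` serves `Q` and `τ(Q)`.

Call two cubes of the same level and with the same `ω` in conflict if property (2) fails for them;
then one of `P_{Q₁}`, `P_{τ(Q₁)}` coincides with one of `P_{Q₂}`, `P_{τ(Q₂)}`. A cube of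
level `k - 3` contains the centers of boundedly many cubes of level `k`, since those centers are
separated and the space is doubling (`DyadicSystem.encard_center_mem_ball_le`). As `τ` is
injective, every cube has a bounded number of conflicts, and the conflict graph is colored greedily
(`exists_coloring_of_encard_le`); the color is the parameter `i`.

The parameter `j` is the level modulo `4T`. If `Q₁ ⊊ Q₂` have the same `j`, then the level of `Q₁`
exceeds that of `Q₂` by at least `T`, so `P_{Q₁}^*` is of level at least that of `P_{Q₂}`, and
these two cubes meet in `Q₁`.
-/

/-! ### Greedy coloring -/

/-- A graph, possibly infinite, in which every vertex has at most `d` neighbors has a proper coloring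
with `d + 1` colors: color the vertices greedily along a well-ordering. -/
theorem exists_coloring_of_encard_le {V : Type*} (adj : V → V → Prop)
    (hsymm : ∀ v w, adj v w → adj w v) (d : ℕ) (hd : ∀ v, {w | adj v w}.encard ≤ d) :
    ∃ c : V → Fin (d + 1), ∀ v w, v ≠ w → adj v w → c v ≠ c w := by
  classical
  have wf : WellFounded (WellOrderingRel (α := V)) := IsWellFounded.wf
  let F : (v : V) → ((w : V) → WellOrderingRel w v → Fin (d + 1)) → Fin (d + 1) := fun v ih =>
    if h : ∃ i, ∀ w (hw : WellOrderingRel w v), adj v w → ih w hw ≠ i then h.choose else 0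
  let c := wf.fix F
  have hc : ∀ v w, WellOrderingRel w v → adj v w → c w ≠ c v := by
    intro v
    have hfree : ∃ i, ∀ w, WellOrderingRel w v → adj v w → c w ≠ i := by
      by_contra! hcon
      have hsub : (univ : Set (Fin (d + 1))) ⊆ c '' {w | adj v w} := fun i _ => by
        obtain ⟨w, -, hw, rfl⟩ := hcon i
        exact ⟨w, hw, rfl⟩
      have hle := (encard_le_encard hsub).trans ((encard_image_le _ _).trans (hd v))
      rw [encard_univ, ENat.card_eq_coe_fintype_card, Fintype.card_fin] at hle
      have : d + 1 ≤ d := by exact_mod_cast hle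
      omega
    have hv : c v = hfree.choose := by
      change wf.fix F v = _
      rw [wf.fix_eq]
      exact dif_pos hfree
    rw [hv]
    exact hfree.choose_spec
  refine ⟨c, fun v w hvw hadj => ?_⟩
  rcases trichotomous_of WellOrderingRel v w with h | h | h
  · exact hc w v h (hsymm v w hadj)
  · exact absurd h hvw
  · exact (hc v w h hadj).symm

/-! ### Packing in doubling spaces -/

namespace GeometricallyDoubling

variable {X : Type u} [MetricSpace X] {M : ℕ}

theorem exists_cover (hX : GeometricallyDoubling X M) (n : ℕ) (x : X) (r : ℝ) (hr : 0 < r) :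
    ∃ s : Finset X, s.card ≤ M ^ n ∧ ball x r ⊆ ⋃ y ∈ s, ball y (r / 2 ^ n) := by
  classical
  induction n with
  | zero => exact ⟨{x}, by simp, by simp⟩
  | succ n ih =>
    obtain ⟨s, hs, hsub⟩ := ih
    choose t ht htsub using fun y => hX y (r / 2 ^ n) (by positivity)
    refine ⟨s.biUnion t, ?_, fun a ha => ?_⟩
    · rw [pow_succ]
      exact (Finset.card_biUnion_le_card_mul _ _ _ fun y _ => ht y).trans
        (Nat.mul_le_mul_right _ hs)
    · obtain ⟨y, hy, hay⟩ := mem_iUnion₂.1 (hsub ha)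
      obtain ⟨b, hb, hab⟩ := mem_iUnion₂.1 (htsub y hay)
      rw [div_div, ← pow_succ] at hab
      exact mem_iUnion₂.2 ⟨b, Finset.mem_biUnion.2 ⟨y, hy, hb⟩, hab⟩

theorem encard_le_of_separated (hX : GeometricallyDoubling X M) {ι : Type*} {A : Set ι} {f : ι → X}
    {x : X} {r ε : ℝ} {n : ℕ} (hr : 0 < r) (hA : ∀ a ∈ A, f a ∈ ball x r)
    (hsep : ∀ a ∈ A, ∀ b ∈ A, a ≠ b → ε ≤ dist (f a) (f b)) (hn : 2 * r / 2 ^ n ≤ ε) :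
    A.encard ≤ (M ^ n : ℕ) := by
  obtain ⟨s, hs, hsub⟩ := hX.exists_cover n x r hr
  have key : ∀ a ∈ A, ∃ y ∈ s, f a ∈ ball y (r / 2 ^ n) := fun a ha => by
    simpa using hsub (hA a ha)
  have : Nonempty X := ⟨x⟩
  choose! g hgs hg using key
  calc A.encard ≤ (s : Set X).encard := by
        refine encard_le_encard_of_injOn (f := g) hgs fun a ha b hb hab => ?_
        by_contra hne
        have h1 := mem_ball.1 (hg a ha)
        have h2 := mem_ball.1 (hg b hb)
        rw [← hab] at h2
        have h3 := hsep a ha b hb hne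
        have h4 := dist_triangle_right (f a) (f b) (g a)
        have h5 : 2 * r / 2 ^ n = r / 2 ^ n + r / 2 ^ n := by ring
        linarith
    _ ≤ (M ^ n : ℕ) := by
        rw [encard_coe_eq_coe_finsetCard]
        exact_mod_cast hs

end GeometricallyDoubling

/-! ### Cubes of dyadic systems -/

namespace DyadicSystem

variable {X : Type u} [MetricSpace X] {δ : ℝ} {D : DyadicSystem X δ}

theorem Cube.center_mem (hδ : 0 < δ) (R : D.Cube) : R.center ∈ R.pts :=
  D.ball_subset R.1 R.2 (mem_ball_self (by positivity))

theorem Cube.eq_of_mem {R S : D.Cube} (h : R.lev = S.lev) {x : X} (hR : x ∈ R.pts)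
    (hS : x ∈ S.pts) : R = S := by
  obtain ⟨k, α⟩ := R
  obtain ⟨l, β⟩ := S
  obtain rfl : k = l := h
  by_contra hne
  exact Set.disjoint_left.1 (D.disjoint k α β fun hαβ => hne (hαβ ▸ rfl)) hR hS

/-- Of two cubes with a common point, the one of higher level is contained in the other. -/
theorem Cube.subset_of_lev_le {R S : D.Cube} (h : S.lev ≤ R.lev) {x : X} (hR : x ∈ R.pts)
    (hS : x ∈ S.pts) : R.pts ⊆ S.pts := by
  obtain ⟨p, hp⟩ := Int.le.dest h
  obtain ⟨S', ⟨hlev, hsub⟩, -⟩ := R.existsUnique_ancestor ⟨x, hR⟩ p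
  obtain rfl : S' = S := Cube.eq_of_mem (by omega) (hsub hR) hS
  exact hsub

theorem Cube.lev_lt_of_ssubset (hδ : 0 < δ) {R S : D.Cube} (h : R.pts ⊂ S.pts) :
    S.lev < R.lev := by
  by_contra! hle
  exact h.2 (Cube.subset_of_lev_le hle (h.1 (R.center_mem hδ)) (R.center_mem hδ))

theorem exists_cube (D : DyadicSystem X δ) (k : ℤ) (x : X) :
    ∃ R : D.Cube, R.lev = k ∧ x ∈ R.pts := by
  obtain ⟨α, hα⟩ := mem_iUnion.1 ((D.cover k).symm ▸ mem_univ x)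
  exact ⟨⟨k, α⟩, rfl, hα⟩

/-- The cube of level `k` that contains the point `x`. -/
noncomputable def cubeAt (D : DyadicSystem X δ) (k : ℤ) (x : X) : D.Cube :=
  (D.exists_cube k x).choose

@[simp]
theorem lev_cubeAt (D : DyadicSystem X δ) (k : ℤ) (x : X) : (D.cubeAt k x).lev = k :=
  (D.exists_cube k x).choose_spec.1

theorem mem_cubeAt (D : DyadicSystem X δ) (k : ℤ) (x : X) : x ∈ (D.cubeAt k x).pts :=
  (D.exists_cube k x).choose_spec.2

theorem Cube.subset_cubeAt {R : D.Cube} {k : ℤ} (hk : k ≤ R.lev) {x : X} (hx : x ∈ R.pts) :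
    R.pts ⊆ (D.cubeAt k x).pts :=
  Cube.subset_of_lev_le (by simpa using hk) hx (D.mem_cubeAt k x)

/-- Centers of different cubes of level `k` are at distance at least `δ ^ k / 5`, so doubling bounds
the number of them in a ball whose radius is comparable to `δ ^ k`. -/
theorem encard_center_mem_ball_le {M n : ℕ} (hX : GeometricallyDoubling X M) (hδ : 0 < δ)
    (hn : 30 * δ ^ (-3 : ℤ) ≤ 2 ^ n) (k : ℤ) (x : X) :
    {R : D.Cube | R.lev = k ∧ R.center ∈ ball x (3 * δ ^ (k - 3))}.encard ≤ (M ^ n : ℕ) := by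
  refine hX.encard_le_of_separated (f := Cube.center) (x := x) (r := 3 * δ ^ (k - 3))
    (ε := 1 / 5 * δ ^ k) (by positivity) (fun R hR => hR.2) ?_ ?_
  · rintro R ⟨hR, -⟩ S ⟨hS, -⟩ hne
    by_contra! hlt
    refine hne (Cube.eq_of_mem (hR.trans hS.symm) (R.center_mem hδ) (D.ball_subset S.1 S.2 ?_))
    change dist R.center S.center < 1 / 5 * δ ^ S.lev
    rwa [hS]
  · have h : δ ^ (k - 3) = δ ^ k * δ ^ (-3 : ℤ) := by rw [← zpow_add₀ hδ.ne', sub_eq_add_neg]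
    rw [h, div_le_iff₀ (by positivity)]
    have := mul_le_mul_of_nonneg_left hn (by positivity : 0 ≤ 1 / 5 * δ ^ k)
    linarith

/-- The adjacency property for the balls `B_Q` and `B_S`: one of the adjacent systems has cubes of
level `lev Q - 3` that contain `Q` and `S`, and a cube `T` levels above that contains `2mB_Q`. -/
theorem exists_good_index (hδ : 0 < δ) (hδ3 : 3 * δ < 1) {K : ℕ}
    {𝒜 : Fin K → DyadicSystem X δ} (h𝒜 : IsAdjacentFamily 2 𝒜) {m : ℝ} {T : ℕ}
    (hT : 2 * m * δ ^ T ≤ 1) (Q S : D.Cube) (hlev : S.lev = Q.lev) :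
    ∃ ω : Fin K,
      Q.pts ⊆ ((𝒜 ω).cubeAt (Q.lev - 3) Q.center).pts ∧
      S.pts ⊆ ((𝒜 ω).cubeAt (Q.lev - 3) S.center).pts ∧
      Q.dilatedBall (2 * m) ⊆ ((𝒜 ω).cubeAt (Q.lev - 3 - T) Q.center).pts := by
  obtain ⟨ω, hω⟩ := h𝒜 T ![Q.center, S.center] (fun _ => 3 * δ ^ Q.lev) fun _ => by positivity
  have hδ1 : δ < 1 := by linarith
  -- `ℓ(R) ≤ 3δ^(k-2) < δ^(k-3)` because `3δ < 1`.
  have hlevel : ∀ R : (𝒜 ω).Cube, δ ^ R.lev ≤ δ ^ (-2 : ℤ) * (3 * δ ^ Q.lev) →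
      Q.lev - 3 < R.lev := fun R hR => by
    refine (zpow_lt_zpow_iff_right_of_lt_one₀ hδ hδ1).1 (hR.trans_lt ?_)
    have h : δ ^ (-2 : ℤ) * (3 * δ ^ Q.lev) = 3 * δ * δ ^ (Q.lev - 3) := by
      have h' : δ * δ ^ (Q.lev - 3) = δ ^ (-2 : ℤ) * δ ^ Q.lev := by
        rw [← zpow_one_add₀ hδ.ne', ← zpow_add₀ hδ.ne']
        ring_nf
      rw [mul_assoc 3, h']
      ring
    rw [h]
    exact mul_lt_of_lt_one_left (by positivity) hδ3
  obtain ⟨R, R', hR, hRl, ⟨hR'l, -⟩, hR'⟩ := hω 0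
  obtain ⟨U, U', hU, hUl, -, -⟩ := hω 1
  simp only [Matrix.cons_val_zero, Matrix.cons_val_one] at hR hR' hU
  have hRlev := hlevel R hRl
  have hUlev := hlevel U hUl
  have hSU : S.pts ⊆ U.pts := (D.subset_ball S.1 S.2).trans (by
    change ball S.center (3 * δ ^ S.lev) ⊆ _
    rwa [hlev])
  refine ⟨ω, ?_, ?_, ?_⟩
  · exact (D.subset_ball Q.1 Q.2).trans
      (hR.trans (Cube.subset_cubeAt hRlev.le (hR (mem_ball_self (by positivity)))))
  · exact hSU.trans (Cube.subset_cubeAt hUlev.le (hSU (S.center_mem hδ)))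
  · refine (ball_subset_ball ?_).trans
      (hR'.trans (Cube.subset_cubeAt (by omega) (hR' (mem_ball_self (by positivity)))))
    have h : 2 * m ≤ δ ^ (-(T : ℤ)) := by
      rw [zpow_neg, zpow_natCast, ← one_div, le_div_iff₀ (by positivity)]
      exact hT
    exact mul_le_mul_of_nonneg_right h (by positivity)

end DyadicSystem

/-! ### The number of generations -/

theorem exists_isLeast_generations {δ m : ℝ} (hδ : 0 < δ) (hδ1 : δ < 1) (hm : 1 ≤ m) :
    ∃ T : ℕ, IsLeast {t : ℕ | 1 ≤ t ∧ 2 * m * δ ^ t ≤ 1} T ∧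
      (T : ℝ) ≤ 1 + Real.log (2 * m) / Real.log (1 / δ) := by
  classical
  have hex : ∃ t : ℕ, 1 ≤ t ∧ 2 * m * δ ^ t ≤ 1 := by
    obtain ⟨n, hn⟩ := exists_pow_lt_of_lt_one (show (0 : ℝ) < 1 / (2 * m) by positivity) hδ1
    refine ⟨n + 1, by omega, ?_⟩
    rw [lt_div_iff₀ (by positivity)] at hn
    have : δ ^ (n + 1) ≤ δ ^ n := pow_le_pow_of_le_one hδ.le hδ1.le n.le_succ
    nlinarith
  refine ⟨Nat.find hex, ⟨Nat.find_spec hex, fun t ht => Nat.find_min' hex ht⟩, ?_⟩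
  have hlog : 0 < Real.log (1 / δ) := Real.log_pos (one_lt_one_div hδ hδ1)
  have h1 := (Nat.find_spec hex).1
  obtain ⟨n, hn⟩ : ∃ n, Nat.find hex = n + 1 := ⟨Nat.find hex - 1, by omega⟩
  have hmin : n * Real.log (1 / δ) ≤ Real.log (2 * m) := by
    rcases Nat.eq_zero_or_pos n with rfl | hpos
    · simpa using Real.log_nonneg (by linarith)
    · have hlt : ¬ (1 ≤ n ∧ 2 * m * δ ^ n ≤ 1) := Nat.find_min hex (by omega)
      have hlt' : 1 < 2 * m * δ ^ n := by
        by_contra! h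
        exact hlt ⟨hpos, h⟩
      rw [← Real.log_pow]
      refine Real.log_le_log (by positivity) ?_
      rw [one_div, inv_pow, inv_le_iff_one_le_mul₀ (by positivity)]
      exact hlt'.le
  rw [hn, Nat.cast_succ, add_comm]
  gcongr
  rwa [le_div_iff₀ hlog]

/-! ### The decomposition -/

theorem mainTheorem2 (M : ℕ) (δ : ℝ) (hδ_pos : 0 < δ) (hδ : δ < 1 / (2 * (168 * (M : ℝ) ^ 8))) :
    -- the number `L` depends only on `M` and `δ`, in particular not on `m` and `τ`
    ∃ L : ℕ, ∀ (X : Type u) [MetricSpace X], GeometricallyDoubling X M →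
      ∀ (D : DyadicSystem X δ) (K : ℕ) (𝒜 : Fin K → DyadicSystem X δ), IsAdjacentFamily 2 𝒜 →
      ∀ (m : ℝ), 1 ≤ m →
      ∀ τ : D.Cube → D.Cube, Function.Injective τ →
        (∀ Q : D.Cube, (τ Q).lev = Q.lev) →
        (∀ Q : D.Cube, (τ Q).pts ⊆ Q.dilatedBall m) →
      ∃ T : ℕ, IsLeast {t : ℕ | 1 ≤ t ∧ 2 * m * δ ^ t ≤ 1} T ∧
        (T : ℝ) ≤ 1 + Real.log (2 * m) / Real.log (1 / δ) ∧
        ∃ 𝒟 : Fin L × Fin (4 * T) × Fin K → Set D.Cube,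
          Pairwise (fun l₁ l₂ => Disjoint (𝒟 l₁) (𝒟 l₂)) ∧
          (⋃ l, 𝒟 l) = Set.univ ∧
          ∀ (i : Fin L) (j : Fin (4 * T)) (ω : Fin K),
            ∃ P Pstar : D.Cube → (𝒜 ω).Cube,
              (∀ Q ∈ 𝒟 (i, j, ω),
                (P Q).lev = Q.lev - 3 ∧ (P (τ Q)).lev = Q.lev - 3 ∧
                (Pstar Q).lev = Q.lev - 3 - T ∧
                Q.pts ⊆ (P Q).pts ∧ (τ Q).pts ⊆ (P (τ Q)).pts ∧
                (P Q).pts ∪ (P (τ Q)).pts ∪ Q.dilatedBall (2 * m) ⊆ (Pstar Q).pts) ∧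
              (∀ Q₁ ∈ 𝒟 (i, j, ω), ∀ Q₂ ∈ 𝒟 (i, j, ω), Q₁.lev = Q₂.lev → Q₁ ≠ Q₂ →
                ((P Q₁).pts ∪ (P (τ Q₁)).pts) ∩ ((P Q₂).pts ∪ (P (τ Q₂)).pts) = ∅) ∧
              (∀ Q₁ ∈ 𝒟 (i, j, ω), ∀ Q₂ ∈ 𝒟 (i, j, ω), Q₁.pts ⊂ Q₂.pts →
                (Pstar Q₁).pts ⊆ (P Q₂).pts) := by
  -- For `M = 0` the bound on `δ` reads `δ < 1 / 0 = 0`.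
  have hM : (1 : ℝ) ≤ M := by
    rcases Nat.eq_zero_or_pos M with rfl | h
    · norm_num at hδ
      linarith
    · exact_mod_cast h
  have hδ3 : 3 * δ < 1 := by
    have hM8 : (1 : ℝ) ≤ (M : ℝ) ^ 8 := one_le_pow₀ hM
    rw [lt_div_iff₀ (by positivity)] at hδ
    nlinarith
  have hδ1 : δ < 1 := by linarith
  -- Balls of radius `3δ^(k-3) / 2^n` then contain at most one center of a cube of level `k`.
  obtain ⟨n, hn⟩ := pow_unbounded_of_one_lt (30 * δ ^ (-3 : ℤ)) (one_lt_two (α := ℝ))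
  refine ⟨4 * M ^ n + 1, fun X _ hX D K 𝒜 h𝒜 m hm τ hτ hτlev hτball => ?_⟩
  obtain ⟨T, hT, hTlog⟩ := exists_isLeast_generations hδ_pos hδ1 hm
  refine ⟨T, hT, hTlog, ?_⟩
  have hT1 : 1 ≤ T := hT.1.1
  choose ω hω using fun Q : D.Cube =>
    DyadicSystem.exists_good_index hδ_pos hδ3 h𝒜 hT.1.2 Q (τ Q) (hτlev Q)
  let P : (w : Fin K) → D.Cube → (𝒜 w).Cube := fun w Q => (𝒜 w).cubeAt (Q.lev - 3) Q.center
  have hPlev : ∀ w Q, (P w Q).lev = Q.lev - 3 := fun w Q => (𝒜 w).lev_cubeAt _ _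
  have hPmem : ∀ w Q, Q.center ∈ (P w Q).pts := fun w Q => (𝒜 w).mem_cubeAt _ _
  let U : Fin K → D.Cube → Set X := fun w Q => (P w Q).pts ∪ (P w (τ Q)).pts
  let conflict : D.Cube → D.Cube → Prop := fun Q₁ Q₂ =>
    Q₁.lev = Q₂.lev ∧ ω Q₁ = ω Q₂ ∧ (U (ω Q₁) Q₁ ∩ U (ω Q₁) Q₂).Nonempty
  have hsymm : ∀ Q₁ Q₂, conflict Q₁ Q₂ → conflict Q₂ Q₁ := by
    rintro Q₁ Q₂ ⟨h1, h2, h3⟩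
    exact ⟨h1.symm, h2.symm, by rwa [← h2, inter_comm]⟩
  -- The neighbors of `Q₁` have their own center, or that of their image, in `P_{Q₁}` or `P_{τ(Q₁)}`.
  have hdeg : ∀ Q₁, {Q₂ | conflict Q₁ Q₂}.encard ≤ (4 * M ^ n : ℕ) := by
    intro Q₁
    let A : D.Cube → Set D.Cube := fun S =>
      {R | R.lev = Q₁.lev ∧
        R.center ∈ ball (P (ω Q₁) S).center (3 * δ ^ (Q₁.lev - 3))}
    have hA : ∀ S, (A S).encard ≤ (M ^ n : ℕ) := fun S =>
      DyadicSystem.encard_center_mem_ball_le hX hδ_pos hn.le _ _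
    have hτA : ∀ S, (τ ⁻¹' A S).encard ≤ (M ^ n : ℕ) := fun S =>
      (encard_le_encard_of_injOn (f := τ) (fun _ h => h) hτ.injOn).trans (hA S)
    have hmem : ∀ S R : D.Cube, S.lev = Q₁.lev → R.lev = Q₁.lev →
        ∀ x ∈ (P (ω Q₁) S).pts, x ∈ (P (ω Q₁) R).pts → R ∈ A S := by
      intro S R hS hR x hxS hxR
      have heq : P (ω Q₁) R = P (ω Q₁) S :=
        DyadicSystem.Cube.eq_of_mem (by rw [hPlev, hPlev, hS, hR]) hxR hxS
      refine ⟨hR, ?_⟩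
      have h := (𝒜 (ω Q₁)).subset_ball _ _ (heq ▸ hPmem (ω Q₁) R)
      rw [← hS, ← hPlev (ω Q₁) S]
      exact h
    have hsub : {Q₂ | conflict Q₁ Q₂} ⊆
        (A Q₁ ∪ τ ⁻¹' A Q₁) ∪ (A (τ Q₁) ∪ τ ⁻¹' A (τ Q₁)) := by
      rintro Q₂ ⟨hlev, -, x, hx1 | hx1, hx2 | hx2⟩
      · exact Or.inl (Or.inl (hmem _ _ rfl hlev.symm x hx1 hx2))
      · exact Or.inl (Or.inr (hmem _ _ rfl ((hτlev _).trans hlev.symm) x hx1 hx2))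
      · exact Or.inr (Or.inl (hmem _ _ (hτlev _) hlev.symm x hx1 hx2))
      · exact Or.inr (Or.inr (hmem _ _ (hτlev _) ((hτlev _).trans hlev.symm) x hx1 hx2))
    calc {Q₂ | conflict Q₁ Q₂}.encard
        ≤ ((A Q₁).encard + (τ ⁻¹' A Q₁).encard) +
            ((A (τ Q₁)).encard + (τ ⁻¹' A (τ Q₁)).encard) :=
          (encard_le_encard hsub).trans ((encard_union_le _ _).trans
            (add_le_add (encard_union_le _ _) (encard_union_le _ _)))
      _ ≤ (((M ^ n : ℕ) : ℕ∞) + (M ^ n : ℕ)) + ((M ^ n : ℕ) + (M ^ n : ℕ)) :=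
          add_le_add (add_le_add (hA _) (hτA _)) (add_le_add (hA _) (hτA _))
      _ = (4 * M ^ n : ℕ) := by
          norm_cast
          ring
  obtain ⟨c, hc⟩ := exists_coloring_of_encard_le conflict hsymm _ hdeg
  have hT0 : (0 : ℤ) < (4 * T : ℕ) := by exact_mod_cast (by omega : 0 < 4 * T)
  let res : D.Cube → Fin (4 * T) := fun Q => ⟨(Q.lev % (4 * T : ℕ)).toNat, by
    have := Int.emod_lt_of_pos Q.lev hT0
    have := Int.emod_nonneg Q.lev hT0.ne'
    omega⟩
  have hres : ∀ Q₁ Q₂, res Q₁ = res Q₂ → Q₂.lev < Q₁.lev → Q₂.lev + T ≤ Q₁.lev := by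
    intro Q₁ Q₂ h hlt
    have h' : (Q₁.lev % (4 * T : ℕ)).toNat = (Q₂.lev % (4 * T : ℕ)).toNat := congrArg Fin.val h
    have h1 := Int.emod_nonneg Q₁.lev hT0.ne'
    have h2 := Int.emod_nonneg Q₂.lev hT0.ne'
    have hdvd : ((4 * T : ℕ) : ℤ) ∣ Q₁.lev - Q₂.lev :=
      Int.ModEq.dvd (show Q₂.lev % (4 * T : ℕ) = Q₁.lev % (4 * T : ℕ) by omega)
    have := Int.le_of_dvd (by omega) hdvd
    push_cast at this
    omega
  refine ⟨fun l => {Q | (c Q, res Q, ω Q) = l}, fun l₁ l₂ hl => ?_, ?_, fun i j w =>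
    ⟨P w, fun Q => (𝒜 w).cubeAt (Q.lev - 3 - T) Q.center, ?_, ?_, ?_⟩⟩
  · exact Set.disjoint_left.2 fun Q h1 h2 => hl (h1.symm.trans h2)
  · exact eq_univ_of_forall fun Q => mem_iUnion.2 ⟨_, rfl⟩
  · intro Q hQ
    obtain ⟨-, -, rfl⟩ : c Q = i ∧ res Q = j ∧ ω Q = w := by simpa using hQ
    obtain ⟨hQP, hτP, hQstar⟩ := hω Q
    have hPτ : P (ω Q) (τ Q) = (𝒜 (ω Q)).cubeAt (Q.lev - 3) (τ Q).center := by
      simp only [P, hτlev]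
    rw [← hPτ] at hτP
    refine ⟨hPlev _ _, by rw [hPlev, hτlev], (𝒜 (ω Q)).lev_cubeAt _ _, hQP, hτP,
      union_subset (union_subset ?_ ?_) hQstar⟩
    · exact DyadicSystem.Cube.subset_cubeAt (by rw [hPlev]; omega) (hPmem _ _)
    -- `τ(Q) ⊆ mB_Q ⊆ P_Q^*`, so `P_{τ(Q)}` meets `P_Q^*`.
    · refine DyadicSystem.Cube.subset_of_lev_le ?_ (hPmem _ _)
        (hQstar (ball_subset_ball ?_ (hτball Q ((τ Q).center_mem hδ_pos))))
      · rw [DyadicSystem.lev_cubeAt, hPlev, hτlev]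
        omega
      · exact mul_le_mul_of_nonneg_right (by linarith) (by positivity)
  · intro Q₁ h1 Q₂ h2 hlev hne
    obtain ⟨hc1, -, rfl⟩ : c Q₁ = i ∧ res Q₁ = j ∧ ω Q₁ = w := by simpa using h1
    obtain ⟨hc2, -, hω2⟩ : c Q₂ = i ∧ res Q₂ = j ∧ ω Q₂ = ω Q₁ := by simpa using h2
    by_contra hcon
    exact hc Q₁ Q₂ hne ⟨hlev, hω2.symm, nonempty_iff_ne_empty.2 hcon⟩ (hc1.trans hc2.symm)
  · intro Q₁ h1 Q₂ h2 hss
    obtain ⟨-, hj1, rfl⟩ : c Q₁ = i ∧ res Q₁ = j ∧ ω Q₁ = w := by simpa using h1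
    obtain ⟨-, hj2, hω2⟩ : c Q₂ = i ∧ res Q₂ = j ∧ ω Q₂ = ω Q₁ := by simpa using h2
    have hgap := hres Q₁ Q₂ (hj1.trans hj2.symm)
      (DyadicSystem.Cube.lev_lt_of_ssubset hδ_pos hss)
    have hQ2 : Q₂.pts ⊆ (P (ω Q₁) Q₂).pts := hω2 ▸ (hω Q₂).1
    refine DyadicSystem.Cube.subset_of_lev_le ?_ ((𝒜 (ω Q₁)).mem_cubeAt _ _)
      (hQ2 (hss.1 (Q₁.center_mem hδ_pos)))
    rw [hPlev, DyadicSystem.lev_cubeAt]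
    omega
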